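/- Let $(p_n)_{n\ge 1}$ be a sequence of real numbers with $p_n \to p_0$, where $0<p_0<1$, and let $(j_n)_{n\ge 1}$ be a sequence of non-negative integers such that $j_n/n \to j_0 \in \mathbb{R}$. Then, as $n\to\infty$, \[ \sum_{k=0}^{j_n} \binom{n}{k} p_n^k (1-p_n)^{n-k} = O\big(n^{-5/2}\big) \quad\text{if } j_0<p_0, \] \[ \sum_{k=0}^{j_n} \binom{n}{k} p_n^k (1-p_n)^{n-k} = 1 + O\big(n^{-5/2}\big) \quad\text{if } j_0>p_0, \] where terms with $k>n$, if any, are zero because $\binom{n}{k}=0$. -/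

import Mathlib

open Filter Topology Asymptotics

/-! Chernoff's method: eventually `j n` stays at least `δ * n` away from the mean `p n * n`, for a
fixed `δ > 0`. The exponential-moment bound `sum_binomialWeight_le_exp`, with `t` negative or
positive, bounds the lower or upper tail by `exp (-(δ ^ 2 / 4) * n)`, which is smaller than any
power of `n`. -/

/-- The weight that the binomial distribution with parameters `n` and `p` gives to `k`. -/
def binomialWeight (n : ℕ) (p : ℝ) (k : ℕ) : ℝ :=
  (n.choose k : ℝ) * p ^ k * (1 - p) ^ (n - k)

theorem binomialWeight_nonneg {p : ℝ} (h0 : 0 ≤ p) (h1 : p ≤ 1) (n k : ℕ) :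
    0 ≤ binomialWeight n p k := by
  have : 0 ≤ 1 - p := by linarith
  unfold binomialWeight
  positivity

theorem binomialWeight_eq_zero {n k : ℕ} (h : n < k) (p : ℝ) : binomialWeight n p k = 0 := by
  simp [binomialWeight, Nat.choose_eq_zero_of_lt h]

theorem sum_binomialWeight_mul_pow (n : ℕ) (p x : ℝ) :
    ∑ k ∈ Finset.range (n + 1), binomialWeight n p k * x ^ k = (p * x + (1 - p)) ^ n := by
  rw [add_pow]
  refine Finset.sum_congr rfl fun k _ => ?_
  rw [binomialWeight, mul_pow]
  ring

theorem sum_binomialWeight (n : ℕ) (p : ℝ) :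
    ∑ k ∈ Finset.range (n + 1), binomialWeight n p k = 1 := by
  simpa using sum_binomialWeight_mul_pow n p 1

/-- Chernoff bound: the weight of a set of integers lying on one side of `m`. -/
theorem sum_binomialWeight_le_exp {p t : ℝ} (h0 : 0 ≤ p) (h1 : p ≤ 1) (ht : |t| ≤ 1)
    (n m : ℕ) (S : Finset ℕ) (hS : ∀ k ∈ S, t * m ≤ t * k) :
    ∑ k ∈ S, binomialWeight n p k ≤ Real.exp (n * (p * t + t ^ 2) - t * m) := by
  have hb := binomialWeight_nonneg h0 h1 n
  have hexp : Real.exp t ≤ 1 + t + t ^ 2 := by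
    have := (abs_le.1 (Real.abs_exp_sub_one_sub_id_le ht)).2
    linarith
  have hbase : p * Real.exp t + (1 - p) ≤ Real.exp (p * t + t ^ 2) := by
    have h2 := Real.add_one_le_exp (p * t + t ^ 2)
    have h3 := mul_le_mul_of_nonneg_left hexp h0
    have h4 := mul_le_mul_of_nonneg_right h1 (sq_nonneg t)
    linarith
  calc ∑ k ∈ S, binomialWeight n p k
      -- Each weight is multiplied by `exp (t * (k - m))`, at least 1 on `S`.
      ≤ ∑ k ∈ S, binomialWeight n p k * Real.exp t ^ k * Real.exp (-(t * m)) := by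
        refine Finset.sum_le_sum fun k hk => ?_
        rw [mul_assoc, ← Real.exp_nat_mul, ← Real.exp_add]
        refine le_mul_of_one_le_right (hb k) (Real.one_le_exp ?_)
        have := hS k hk
        linarith
    _ ≤ ∑ k ∈ S ∪ Finset.range (n + 1),
          binomialWeight n p k * Real.exp t ^ k * Real.exp (-(t * m)) :=
        Finset.sum_le_sum_of_subset_of_nonneg Finset.subset_union_left fun k _ _ => by
          have := hb k
          positivity
    _ = ∑ k ∈ Finset.range (n + 1),
          binomialWeight n p k * Real.exp t ^ k * Real.exp (-(t * m)) := by
        refine (Finset.sum_subset Finset.subset_union_right fun k _ hk => ?_).symm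
        rw [binomialWeight_eq_zero (by simpa [Nat.lt_succ_iff] using hk)]
        simp
    _ = (p * Real.exp t + (1 - p)) ^ n * Real.exp (-(t * m)) := by
        rw [← Finset.sum_mul, sum_binomialWeight_mul_pow]
    _ ≤ Real.exp (p * t + t ^ 2) ^ n * Real.exp (-(t * m)) := by
        have : 0 ≤ 1 - p := by linarith
        gcongr
    _ = Real.exp (n * (p * t + t ^ 2) - t * m) := by
        rw [← Real.exp_nat_mul, ← Real.exp_add, ← sub_eq_add_neg]

theorem sum_binomialWeight_lower_tail_le {p δ : ℝ} (h0 : 0 ≤ p) (h1 : p ≤ 1) (hδ0 : 0 ≤ δ)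
    (hδ1 : δ ≤ 1) (n m : ℕ) (hm : (m : ℝ) ≤ (p - δ) * n) :
    ∑ k ∈ Finset.range (m + 1), binomialWeight n p k ≤ Real.exp (-(δ ^ 2 / 4) * n) := by
  -- `|t| = δ / 2` minimises the exponent `t ^ 2 - δ * |t|`, giving `-δ ^ 2 / 4`.
  refine (sum_binomialWeight_le_exp (t := -(δ / 2)) h0 h1 (by
    rw [abs_neg, abs_of_nonneg] <;> linarith) n m _ fun k hk => ?_).trans
    (Real.exp_le_exp.2 ?_)
  · have : (k : ℝ) ≤ m := by exact_mod_cast Nat.lt_succ_iff.1 (Finset.mem_range.1 hk)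
    nlinarith
  · have := mul_le_mul_of_nonneg_left hm hδ0
    linarith

theorem one_sub_sum_binomialWeight (n m : ℕ) (p : ℝ) :
    1 - ∑ k ∈ Finset.range (m + 1), binomialWeight n p k =
      ∑ k ∈ Finset.range (n + 1) \ Finset.range (m + 1), binomialWeight n p k := by
  -- The union covers the case `m > n`, where the extra weights vanish.
  have hunion : ∑ k ∈ Finset.range (n + 1) ∪ Finset.range (m + 1), binomialWeight n p k = 1 := by
    rw [← sum_binomialWeight n p]
    refine (Finset.sum_subset Finset.subset_union_left fun k _ hk => ?_).symm
    exact binomialWeight_eq_zero (by simpa [Nat.lt_succ_iff] using hk) p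
  rw [← hunion, ← Finset.sdiff_union_self_eq_union, Finset.sum_union Finset.sdiff_disjoint]
  ring

theorem sum_binomialWeight_upper_tail_le {p δ : ℝ} (h0 : 0 ≤ p) (h1 : p ≤ 1) (hδ0 : 0 ≤ δ)
    (hδ1 : δ ≤ 1) (n m : ℕ) (hm : (p + δ) * n ≤ m) :
    ∑ k ∈ Finset.range (n + 1) \ Finset.range (m + 1), binomialWeight n p k ≤
      Real.exp (-(δ ^ 2 / 4) * n) := by
  refine (sum_binomialWeight_le_exp (t := δ / 2) h0 h1 (by
    rw [abs_of_nonneg] <;> linarith) n m _ fun k hk => ?_).trans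
    (Real.exp_le_exp.2 ?_)
  · have hmk : m ≤ k := by
      have := (Finset.mem_sdiff.1 hk).2
      rw [Finset.mem_range] at this
      omega
    have : (m : ℝ) ≤ k := by exact_mod_cast hmk
    nlinarith
  · have := mul_le_mul_of_nonneg_left hm hδ0
    linarith

theorem isBigO_rpow_of_abs_le_exp {f : ℕ → ℝ} {c : ℝ} (hc : 0 < c) (s : ℝ)
    (hf : ∀ᶠ n : ℕ in atTop, |f n| ≤ Real.exp (-c * n)) :
    f =O[atTop] (fun n : ℕ => (n : ℝ) ^ s) := by
  have hexp := ((isLittleO_exp_neg_mul_rpow_atTop hc s).comp_tendsto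
    (tendsto_natCast_atTop_atTop (R := ℝ))).isBigO
  refine IsBigO.trans (IsBigO.of_bound 1 ?_) hexp
  filter_upwards [hf] with n hn
  simpa using hn

theorem mainTheorem8 (p : ℕ → ℝ) (p₀ : ℝ) (j : ℕ → ℕ) (j₀ : ℝ)
    (hp₀ : 0 < p₀) (hp₁ : p₀ < 1)
    (hp : Tendsto p atTop (𝓝 p₀))
    (hj : Tendsto (fun n : ℕ => (j n : ℝ) / (n : ℝ)) atTop (𝓝 j₀)) :
    (j₀ < p₀ →
      (fun n : ℕ => ∑ k ∈ Finset.range (j n + 1),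
          (n.choose k : ℝ) * p n ^ k * (1 - p n) ^ (n - k))
        =O[atTop] (fun n : ℕ => (n : ℝ) ^ (-(5 / 2) : ℝ))) ∧
    (p₀ < j₀ →
      (fun n : ℕ => (∑ k ∈ Finset.range (j n + 1),
          (n.choose k : ℝ) * p n ^ k * (1 - p n) ^ (n - k)) - 1)
        =O[atTop] (fun n : ℕ => (n : ℝ) ^ (-(5 / 2) : ℝ))) := by
  have hp0 : ∀ᶠ n in atTop, 0 < p n := hp.eventually_const_lt hp₀
  have hp1 : ∀ᶠ n in atTop, p n < 1 := hp.eventually_lt_const hp₁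
  constructor <;> intro h
  -- The cap at 1 ensures `|t| ≤ 1` in the Chernoff bound.
  · obtain ⟨δ, hδ0, hδ⟩ := exists_between (lt_min (sub_pos.2 h) one_pos)
    have hlt := (hp.sub hj).eventually_const_lt (hδ.trans_le (min_le_left _ _))
    refine isBigO_rpow_of_abs_le_exp (c := δ ^ 2 / 4) (by positivity) _ ?_
    filter_upwards [hp0, hp1, hlt, eventually_gt_atTop 0] with n h0 h1 hn hpos
    have hm : (j n : ℝ) ≤ (p n - δ) * n :=
      (div_le_iff₀ (by exact_mod_cast hpos)).1 (by linarith)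
    change |∑ k ∈ Finset.range (j n + 1), binomialWeight n (p n) k| ≤ _
    rw [abs_of_nonneg (Finset.sum_nonneg fun k _ => binomialWeight_nonneg h0.le h1.le n k)]
    exact sum_binomialWeight_lower_tail_le h0.le h1.le hδ0.le
      (hδ.le.trans (min_le_right _ _)) n (j n) hm
  · obtain ⟨δ, hδ0, hδ⟩ := exists_between (lt_min (sub_pos.2 h) one_pos)
    have hlt := (hj.sub hp).eventually_const_lt (hδ.trans_le (min_le_left _ _))
    refine isBigO_rpow_of_abs_le_exp (c := δ ^ 2 / 4) (by positivity) _ ?_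
    filter_upwards [hp0, hp1, hlt, eventually_gt_atTop 0] with n h0 h1 hn hpos
    have hm : (p n + δ) * n ≤ (j n : ℝ) :=
      (le_div_iff₀ (by exact_mod_cast hpos)).1 (by linarith)
    have htail := one_sub_sum_binomialWeight n (j n) (p n)
    rw [abs_sub_comm]
    change |1 - ∑ k ∈ Finset.range (j n + 1), binomialWeight n (p n) k| ≤ _
    rw [htail, abs_of_nonneg (Finset.sum_nonneg fun k _ =>
      binomialWeight_nonneg h0.le h1.le n k)]
    exact sum_binomialWeight_upper_tail_le h0.le h1.le hδ0.le
      (hδ.le.trans (min_le_right _ _)) n (j n) hm
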